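/- Let $R$ be a commutative noetherian ring, let $n\ge 0$, and let $R[[t]][x]=R[[t]][x_1,\dots,x_n]$ be the polynomial ring in $x_1,\dots,x_n$ over the power series ring $R[[t]]$. Let $I$ be an $x$-homogeneous ideal of $R[[t]][x]$, i.e. an ideal generated by elements that are homogeneous as polynomials in $x_1,\dots,x_n$ over $R[[t]]$. A $t$-local monomial ordering is a total ordering $>$ on the set of monomials $t^\beta x^\alpha$ ($\beta\in\mathbb{N}$, $\alpha\in\mathbb{N}^n$) that is compatible with multiplication and satisfies $1>t$. For such $>$ and $0\neq f=\sum_{\beta,\alpha}c_{\beta,\alpha}t^\beta x^\alpha\in R[[t]][x]$, the leading term $\mathrm{lt}_>(f)$ is $c_{\beta,\alpha}t^\beta x^\alpha$, where $t^\beta x^\alpha$ is the greatest monomial with respect to $>$ that occurs in $f$ with nonzero coefficient (it exists because $1>t$); set $\mathrm{lt}_>(0)=0$. The leading ideal of $I$ with respect to $>$ is the ideal $\mathrm{lt}_>(I)=\langle \mathrm{lt}_>(f)\mid f\in I\rangle$ of $R[t,x]=R[t,x_1,\dots,x_n]$. Then the set $$\{\,\mathrm{lt}_>(I)\;\mid\;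 >\text{ a $t$-local monomial ordering}\,\}$$ of ideals of $R[t,x]$ is finite. -/

import Mathlib

noncomputable section

/-- `R⟦t⟧[x₁, …, xₙ]`. -/
abbrev MixedRing (n : ℕ) (R : Type*) [CommRing R] : Type _ :=
  MvPolynomial (Fin n) (PowerSeries R)

/-- The (exponent vectors of) monomials in `t, x₁, …, xₙ`: the exponent of `t` is the entry at `0`,
and the exponent of `xᵢ` is the entry at `i`, for `i = 1, …, n`. Multiplication of monomials is
addition of exponent vectors. -/
abbrev Mon (n : ℕ) : Type := Fin (n + 1) →₀ ℕ

/-- A monomial ordering: a (strict) total ordering on the monomials in `t, x₁, …, xₙ` which is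
compatible with multiplication. It need not be a well-ordering. -/
structure MonomialOrdering (n : ℕ) where
  /-- `gt a b` means `a > b`. -/
  gt : Mon n → Mon n → Prop
  isStrictTotalOrder : IsStrictTotalOrder (Mon n) gt
  gt_add : ∀ a b c : Mon n, gt a b → gt (a + c) (b + c)

namespace MixedRing

variable {n : ℕ} {R : Type*} [CommRing R]

/-- The coefficient in `R` of `t ^ (m 0) * x ^ (m 1, …, m n)` in `f ∈ R⟦t⟧[x]`. -/
def monCoeff (m : Mon n) (f : MixedRing n R) : R :=
  PowerSeries.coeff (m 0) (MvPolynomial.coeff m.tail f)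

/-- An ideal of `R⟦t⟧[x]` is `x`-homogeneous if it is generated by elements that are homogeneous
as polynomials in `x` over `R⟦t⟧`. -/
def IsXHomogeneous (I : Ideal (MixedRing n R)) : Prop :=
  ∃ S : Set (MixedRing n R), (∀ f ∈ S, ∃ d : ℕ, MvPolynomial.IsHomogeneous f d) ∧ Ideal.span S = I

end MixedRing

namespace MonomialOrdering

variable {n : ℕ} {R : Type*} [CommRing R]

/-- `1 > t`. -/
def IsTLocal (o : MonomialOrdering n) : Prop :=
  o.gt 0 (Finsupp.single 0 1)

/-- `m` is the greatest monomial occurring in `f`. -/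
def IsLeadingMonomial (o : MonomialOrdering n) (f : MixedRing n R) (m : Mon n) : Prop :=
  MixedRing.monCoeff m f ≠ 0 ∧
    ∀ m' : Mon n, MixedRing.monCoeff m' f ≠ 0 → m' ≠ m → o.gt m m'

/-- For a `t`-local ordering every nonzero element has a leading monomial. -/
theorem exists_isLeadingMonomial (o : MonomialOrdering n) (ho : o.IsTLocal)
    {f : MixedRing n R} (hf : f ≠ 0) : ∃ m, o.IsLeadingMonomial f m := by
  classical
  have := o.isStrictTotalOrder
  have hstep : ∀ (k : ℕ) (a : Mon n), o.gt a (a + Finsupp.single 0 (k + 1)) := by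
    intro k a
    have h1 : ∀ b : Mon n, o.gt b (b + Finsupp.single 0 1) := fun b => by
      simpa [add_comm] using o.gt_add _ _ b ho
    induction k with
    | zero => exact h1 a
    | succ k ih =>
      refine _root_.trans ih ?_
      have := h1 (a + Finsupp.single 0 (k + 1))
      rwa [add_assoc, ← Finsupp.single_add] at this
  let c : (Fin n →₀ ℕ) → Mon n := fun α =>
    Finsupp.cons (PowerSeries.order (MvPolynomial.coeff α f)).toNat α
  obtain ⟨m, hm, hmax⟩ : ∃ m ∈ f.support.image c,
      ∀ m' ∈ f.support.image c, m' = m ∨ o.gt m m' :=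
    @Finset.exists_max_image _ _ (linearOrderOfSTO (fun a b => o.gt b a)) (f.support.image c) id
      ((MvPolynomial.support_nonempty.mpr hf).image c)
  obtain ⟨α, hα, rfl⟩ := Finset.mem_image.mp hm
  refine ⟨c α, ?_, ?_⟩
  · have h0 : MvPolynomial.coeff α f ≠ 0 := MvPolynomial.mem_support_iff.mp hα
    simpa [MixedRing.monCoeff, c] using PowerSeries.coeff_order h0
  · intro m' hm' hne
    have h0 : MvPolynomial.coeff m'.tail f ≠ 0 := by
      intro h; exact hm' (by simp [MixedRing.monCoeff, h])
    have hle : c m'.tail = c α ∨ o.gt (c α) (c m'.tail) :=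
      hmax _ (Finset.mem_image_of_mem c (MvPolynomial.mem_support_iff.mpr h0))
    have hord : (PowerSeries.order (MvPolynomial.coeff m'.tail f)).toNat ≤ m' 0 := by
      have := PowerSeries.order_le (m' 0) hm'
      exact ENat.toNat_le_of_le_natCast this
    obtain ⟨k, hk⟩ := Nat.exists_eq_add_of_le hord
    have hm'eq : m' = c m'.tail + Finsupp.single 0 k := by
      ext i
      refine Fin.cases ?_ (fun j => ?_) i
      · simp [c, hk.symm]
      · simp [c, Finsupp.tail_apply]
    rcases k with _ | k
    · have h : m' = c m'.tail := by simpa using hm'eq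
      rw [← h] at hle
      exact hle.resolve_left hne
    · have h := hstep k (c m'.tail)
      rw [← hm'eq] at h
      rcases hle with hle | hle
      · rwa [hle] at h
      · exact _root_.trans hle h

open Classical in
/-- The leading term `lt(f) ∈ R[t, x]`, with `lt(0) = 0`. -/
def leadingTerm (o : MonomialOrdering n) (f : MixedRing n R) : MvPolynomial (Fin (n + 1)) R :=
  if h : ∃ m, o.IsLeadingMonomial f m then
    MvPolynomial.monomial h.choose (MixedRing.monCoeff h.choose f)
  else 0

/-- The leading ideal: the ideal of `R[t, x]` generated by the leading terms of all elements
of `I`. -/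
def leadingIdeal (o : MonomialOrdering n) (I : Ideal (MixedRing n R)) :
    Ideal (MvPolynomial (Fin (n + 1)) R) :=
  Ideal.span (o.leadingTerm '' (I : Set (MixedRing n R)))

end MonomialOrdering

end

/-!
Among the leading ideals of `I` there are no proper inclusions. Suppose that every leading
coefficient of `I` for an ordering `>₁` is one for another ordering `>₂`. As `I` is
`x`-homogeneous, it suffices to consider its elements that are homogeneous of degree `d` in `x`,
which form a finitely generated, hence `t`-adically complete, `R⟦t⟧`-module. Dividing `f` in this
module with respect to `>₂` by elements whose leading coefficients come from `>₁` leaves a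
remainder in the module that has no leading term for `>₁`; so it vanishes, and the leading term of
`f` for `>₂` is one for `>₁`.

If there were infinitely many leading ideals, take a limit of the corresponding orderings along a
nonprincipal ultrafilter. Its leading ideal is finitely generated, and that a given element lies in
it is witnessed by finitely many comparisons of monomials, so it is contained in, and hence equal
to, almost all of the given leading ideals.
-/

noncomputable section

open scoped Pointwise PowerSeries

theorem exists_forall_eq_of_wellFounded {α β : Type*} [Nonempty β] {r : α → α → Prop}
    (hr : WellFounded r) (F : (α → β) → α → β)
    (hF : ∀ a b m, (∀ p, r p m → a p = b p) → F a m = F b m) : ∃ a, ∀ m, a m = F a m := by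
  classical
  refine ⟨hr.fix fun m ih => F (fun p => if h : r p m then ih p h else Classical.arbitrary β) m,
    fun m => ?_⟩
  rw [hr.fix_eq]
  exact hF _ _ m fun p hp => dif_pos hp

theorem exists_forall_pow_dvd_sub_sum {A : Type*} [CommRing A] {a : A}
    [IsPrecomplete (Ideal.span {a}) A] (b : ℕ → A) :
    ∃ l, ∀ k, a ^ k ∣ l - ∑ i ∈ Finset.range k, a ^ i * b i := by
  obtain ⟨l, hl⟩ := IsPrecomplete.prec (I := Ideal.span {a}) inferInstance
    (f := fun k => ∑ i ∈ Finset.range k, a ^ i * b i) fun {k l} hkl => by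
      rw [SModEq.comm, SModEq.sub_mem, ← Finset.sum_Ico_eq_sub _ hkl, smul_eq_mul,
        Ideal.mul_top, Ideal.span_singleton_pow, Ideal.mem_span_singleton]
      exact Finset.dvd_sum fun i hi => (pow_dvd_pow a (Finset.mem_Ico.mp hi).1).mul_right _
  refine ⟨l, fun k => ?_⟩
  have hk := hl k
  rwa [SModEq.comm, SModEq.sub_mem, smul_eq_mul, Ideal.mul_top, Ideal.span_singleton_pow,
    Ideal.mem_span_singleton] at hk

theorem exists_forall_sub_mem_pow_smul {A M : Type*} [CommRing A] [AddCommGroup M] [Module A M]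
    {a : A} [IsPrecomplete (Ideal.span {a}) A] {N : Submodule A M} (hN : N.FG) {s : ℕ → M}
    (h0 : s 0 ∈ N) (hs : ∀ k, s (k + 1) - s k ∈ a ^ k • N) :
    ∃ x ∈ N, ∀ k, x - s k ∈ a ^ k • N := by
  obtain ⟨r, e, rfl⟩ := Submodule.fg_iff_exists_fin_generating_family.mp hN
  have hcoeff : ∀ k, ∃ b : Fin r → A, a ^ k • ∑ j, b j • e j = s (k + 1) - s k := fun k => by
    obtain ⟨y, hy, hyk⟩ := (Submodule.mem_smul_pointwise_iff_exists _ _ _).mp (hs k)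
    obtain ⟨b, rfl⟩ := (Submodule.mem_span_range_iff_exists_fun A).mp hy
    exact ⟨b, hyk⟩
  choose b hb using hcoeff
  choose l hl using fun j => exists_forall_pow_dvd_sub_sum (a := a) fun i => b i j
  choose v hv using hl
  have hmem : ∀ c : Fin r → A, ∑ j, c j • e j ∈ Submodule.span A (Set.range e) := fun c =>
    (Submodule.mem_span_range_iff_exists_fun A).mpr ⟨c, rfl⟩
  refine ⟨s 0 + ∑ j, l j • e j, add_mem h0 (hmem l), fun k => ?_⟩
  have hpartial : s k - s 0 = ∑ j, (∑ i ∈ Finset.range k, a ^ i * b i j) • e j := by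
    simp only [← Finset.sum_range_sub, ← hb, Finset.smul_sum, Finset.sum_smul, mul_smul]
    exact Finset.sum_comm
  have hdiff : s 0 + ∑ j, l j • e j - s k = a ^ k • ∑ j, v j k • e j := by
    rw [add_comm, ← sub_sub_eq_add_sub, hpartial, ← Finset.sum_sub_distrib, Finset.smul_sum]
    exact Finset.sum_congr rfl fun j _ => by rw [← sub_smul, hv, mul_smul]
  rw [hdiff]
  exact Submodule.smul_mem_pointwise_smul _ _ _ (hmem _)

namespace MixedRing

variable {n : ℕ} {R : Type*} [CommRing R]

theorem tail_add (m e : Mon n) : (m + e).tail = m.tail + e.tail := by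
  ext i
  simp [Finsupp.tail_apply]

theorem tail_sub (m e : Mon n) : (m - e).tail = m.tail - e.tail := by
  ext i
  simp [Finsupp.tail_apply]

theorem tail_single_zero (k : ℕ) : (Finsupp.single 0 k : Mon n).tail = 0 := by
  ext i
  simp [Finsupp.tail_apply]

theorem le_iff_zero_tail {e m : Mon n} : e ≤ m ↔ e 0 ≤ m 0 ∧ e.tail ≤ m.tail :=
  ⟨fun h => ⟨h 0, fun i => h i.succ⟩, fun h i => Fin.cases h.1 h.2 i⟩

theorem cons_add_single (β k : ℕ) (α : Fin n →₀ ℕ) :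
    Finsupp.cons β α + Finsupp.single 0 k = (Finsupp.cons (β + k) α : Mon n) := by
  ext i
  refine Fin.cases ?_ (fun j => ?_) i <;> simp

/-- `monCoeff m` as an `R`-linear map. -/
def monCoeffₗ (m : Mon n) : MixedRing n R →ₗ[R] R where
  toFun := monCoeff m
  map_add' f g := by simp [monCoeff]
  map_smul' c f := by simp [monCoeff]

@[simp]
theorem monCoeffₗ_apply (m : Mon n) (f : MixedRing n R) : monCoeffₗ m f = monCoeff m f := rfl

@[simp]
theorem monCoeff_zero (m : Mon n) : monCoeff m (0 : MixedRing n R) = 0 := (monCoeffₗ m).map_zero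

theorem monCoeff_sub (m : Mon n) (f g : MixedRing n R) :
    monCoeff m (f - g) = monCoeff m f - monCoeff m g := (monCoeffₗ m).map_sub f g

theorem monCoeff_sum {ι : Type*} (m : Mon n) (s : Finset ι) (f : ι → MixedRing n R) :
    monCoeff m (∑ i ∈ s, f i) = ∑ i ∈ s, monCoeff m (f i) := map_sum (monCoeffₗ m) f s

theorem monCoeff_eq_zero_of_mem_X_pow_smul {N : Submodule R⟦X⟧ (MixedRing n R)} {m : Mon n}
    {k : ℕ} (hk : m 0 < k) {f : MixedRing n R} (hf : f ∈ (PowerSeries.X : R⟦X⟧) ^ k • N) :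
    monCoeff m f = 0 := by
  obtain ⟨g, -, rfl⟩ := (Submodule.mem_smul_pointwise_iff_exists _ _ _).mp hf
  rw [monCoeff, MvPolynomial.coeff_smul, smul_eq_mul, PowerSeries.coeff_X_pow_mul',
    if_neg hk.not_ge]

theorem degree_tail_of_monCoeff_ne_zero {f : MixedRing n R} {d : ℕ} (hf : f.IsHomogeneous d)
    {m : Mon n} (h : monCoeff m f ≠ 0) : m.tail.degree = d := by
  by_contra hd
  rw [monCoeff, hf.coeff_eq_zero hd, map_zero] at h
  exact h rfl

theorem monCoeff_homogeneousComponent (m : Mon n) (d : ℕ) (f : MixedRing n R) :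
    monCoeff m (MvPolynomial.homogeneousComponent d f) =
      if m.tail.degree = d then monCoeff m f else 0 := by
  rw [monCoeff, MvPolynomial.coeff_homogeneousComponent]
  split_ifs <;> simp [monCoeff]

/-- The monomial `t ^ (e 0) * x ^ (e 1, …, e n)` as an element of `R⟦t⟧[x]`. -/
def mon (R : Type*) [CommRing R] (e : Mon n) : MixedRing n R :=
  MvPolynomial.monomial e.tail (PowerSeries.X ^ e 0)

theorem X_pow_smul_eq_mon_mul (k : ℕ) (f : MixedRing n R) :
    (PowerSeries.X : R⟦X⟧) ^ k • f = mon R (Finsupp.single 0 k) * f := by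
  simp [mon, tail_single_zero, MvPolynomial.smul_eq_C_mul]

theorem monCoeff_mon_mul (e m : Mon n) (f : MixedRing n R) :
    monCoeff m (mon R e * f) = if e ≤ m then monCoeff (m - e) f else 0 := by
  simp only [monCoeff, mon, MvPolynomial.coeff_monomial_mul', tail_sub, Finsupp.tsub_apply,
    le_iff_zero_tail (e := e)]
  by_cases h1 : e.tail ≤ m.tail <;> by_cases h0 : e 0 ≤ m 0 <;>
    simp [h1, h0, PowerSeries.coeff_X_pow_mul']

theorem monCoeff_add_mon_mul (e m : Mon n) (f : MixedRing n R) :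
    monCoeff (m + e) (mon R e * f) = monCoeff m f := by
  simp [monCoeff_mon_mul]

/-- The `x`-homogeneous elements of degree `d` of an ideal of `R⟦t⟧[x]`. -/
def homogeneousPart (I : Ideal (MixedRing n R)) (d : ℕ) : Submodule R⟦X⟧ (MixedRing n R) :=
  I.restrictScalars R⟦X⟧ ⊓ MvPolynomial.homogeneousSubmodule (Fin n) R⟦X⟧ d

theorem homogeneousPart_fg [IsNoetherianRing R] (I : Ideal (MixedRing n R)) (d : ℕ) :
    (homogeneousPart I d).FG :=
  (MvPolynomial.homogeneousSubmodule_fg (Fin n) R⟦X⟧ d).of_le inf_le_right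

theorem IsXHomogeneous.homogeneousComponent_mem {I : Ideal (MixedRing n R)}
    (hI : IsXHomogeneous I) (d : ℕ) {f : MixedRing n R} (hf : f ∈ I) :
    MvPolynomial.homogeneousComponent d f ∈ homogeneousPart I d := by
  refine ⟨?_, MvPolynomial.homogeneousComponent_mem d f⟩
  obtain ⟨S, hS, rfl⟩ := hI
  let _ : GradedRing (MvPolynomial.homogeneousSubmodule (Fin n) R⟦X⟧) :=
    MvPolynomial.gradedAlgebra
  have h := Ideal.homogeneous_span (MvPolynomial.homogeneousSubmodule (Fin n) R⟦X⟧) S hS d hf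
  rwa [← MvPolynomial.decomposition.decompose'_apply f d]

/-- The monomials of degree `d` in `x` whose exponent of `t` is less than `k`. -/
def box (n d k : ℕ) : Finset (Mon n) :=
  (((Set.finite_Iio k).prod (Finsupp.finite_of_degree_eq d)).image
    (fun p : ℕ × (Fin n →₀ ℕ) => Finsupp.cons p.1 p.2)).toFinset

@[simp]
theorem mem_box {d k : ℕ} {m : Mon n} : m ∈ box n d k ↔ m.tail.degree = d ∧ m 0 < k := by
  rw [box, Set.Finite.mem_toFinset]
  constructor
  · rintro ⟨⟨β, α⟩, ⟨hβ, hα⟩, rfl⟩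
    exact ⟨by simpa using hα, by simpa using hβ⟩
  · rintro ⟨hd, hk⟩
    exact ⟨(m 0, m.tail), ⟨hk, hd⟩, Finsupp.cons_tail m⟩

/-- The infinite sum `∑ T p` over the monomials `p` of degree `d` in `x` converges `t`-adically
in `N`. -/
theorem exists_mem_forall_monCoeff_eq_sum {N : Submodule R⟦X⟧ (MixedRing n R)} (hN : N.FG)
    (d C : ℕ) {T : Mon n → MixedRing n R}
    (hT : ∀ p, T p ∈ (PowerSeries.X : R⟦X⟧) ^ (p 0 - C) • N) :
    ∃ S ∈ N, ∀ m, monCoeff m S = ∑ p ∈ box n d (C + (m 0 + 1)), monCoeff m (T p) := by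
  have hTN : ∀ p, T p ∈ N := fun p => Submodule.smul_le_self_of_tower _ _ (hT p)
  obtain ⟨S, hSN, hS⟩ := exists_forall_sub_mem_pow_smul (a := (PowerSeries.X : R⟦X⟧)) hN
    (s := fun k => ∑ p ∈ box n d (C + k), T p) (sum_mem fun p _ => hTN p) fun k => by
      have hsub : box n d (C + k) ⊆ box n d (C + (k + 1)) := fun p hp => by
        rw [mem_box] at hp ⊢
        exact ⟨hp.1, by omega⟩
      rw [← Finset.sum_sdiff_eq_sub hsub]
      refine sum_mem fun p hp => ?_
      rw [Finset.mem_sdiff, mem_box, mem_box] at hp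
      have hp0 : p 0 - C = k := by omega
      exact hp0 ▸ hT p
  refine ⟨S, hSN, fun m => ?_⟩
  rw [← monCoeff_sum, ← sub_eq_zero, ← monCoeff_sub]
  exact monCoeff_eq_zero_of_mem_X_pow_smul (Nat.lt_succ_self _) (hS (m 0 + 1))

/-- The lowest monomials in the coefficients of `f`: every monomial occurring in `f` is a power of
`t` times one of these finitely many. -/
def lowestMonomials (f : MixedRing n R) : Set (Mon n) :=
  (fun α => Finsupp.cons (PowerSeries.order (MvPolynomial.coeff α f)).toNat α) '' f.support

theorem lowestMonomials_finite (f : MixedRing n R) : (lowestMonomials f).Finite :=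
  f.support.finite_toSet.image _

theorem monCoeff_ne_zero_of_mem_lowestMonomials {f : MixedRing n R} {p : Mon n}
    (hp : p ∈ lowestMonomials f) : monCoeff p f ≠ 0 := by
  obtain ⟨α, hα, rfl⟩ := hp
  simpa [monCoeff] using PowerSeries.coeff_order (MvPolynomial.mem_support_iff.mp hα)

theorem exists_mem_lowestMonomials {f : MixedRing n R} {p : Mon n} (hp : monCoeff p f ≠ 0) :
    ∃ q ∈ lowestMonomials f, ∃ k, p = q + Finsupp.single 0 k := by
  have hα : MvPolynomial.coeff p.tail f ≠ 0 := fun h => hp (by rw [monCoeff, h, map_zero])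
  obtain ⟨k, hk⟩ := Nat.exists_eq_add_of_le
    (ENat.toNat_le_of_le_natCast (PowerSeries.order_le (p 0) hp))
  refine ⟨_, ⟨p.tail, MvPolynomial.mem_support_iff.mpr hα, rfl⟩, k, ?_⟩
  rw [cons_add_single, ← hk, Finsupp.cons_tail]

end MixedRing

namespace MonomialOrdering

open MixedRing

variable {n : ℕ} {R : Type*} [CommRing R]

section Order

variable (o : MonomialOrdering n) {a b c : Mon n}

theorem gt_trans (h : o.gt a b) (h' : o.gt b c) : o.gt a c :=
  have := o.isStrictTotalOrder
  _root_.trans h h'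

theorem gt_irrefl (a : Mon n) : ¬o.gt a a :=
  have := o.isStrictTotalOrder
  irrefl a

theorem gt_asymm (h : o.gt a b) : ¬o.gt b a := fun h' => o.gt_irrefl a (o.gt_trans h h')

theorem gt_trichotomy (a b : Mon n) : o.gt a b ∨ a = b ∨ o.gt b a :=
  have := o.isStrictTotalOrder
  trichotomous_of o.gt a b

theorem gt_add_iff : o.gt (a + c) (b + c) ↔ o.gt a b := by
  refine ⟨fun h => ?_, o.gt_add a b c⟩
  rcases o.gt_trichotomy a b with hab | rfl | hba
  · exact hab
  · exact absurd h (o.gt_irrefl _)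
  · exact absurd (o.gt_add _ _ c hba) (o.gt_asymm h)

variable {o}

theorem IsTLocal.not_gt_add_single (ho : o.IsTLocal) (a : Mon n) (k : ℕ) :
    ¬o.gt (a + Finsupp.single 0 k) a := by
  induction k with
  | zero => simpa using o.gt_irrefl a
  | succ k ih =>
    have hstep : o.gt (a + Finsupp.single 0 k) (a + Finsupp.single 0 (k + 1)) := by
      rw [Finsupp.single_add, add_comm (Finsupp.single 0 k), ← add_assoc, o.gt_add_iff]
      simpa [add_comm] using o.gt_add _ _ a ho
    exact fun h => ih (o.gt_trans hstep h)

theorem IsTLocal.not_gt_of_le (ho : o.IsTLocal) (hle : a ≤ b)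
    (hdeg : a.tail.degree = b.tail.degree) : ¬o.gt b a := by
  obtain ⟨e, rfl⟩ := exists_add_of_le hle
  have he : e.tail = 0 := by
    rw [← Finsupp.degree_eq_zero_iff]
    rw [tail_add, map_add] at hdeg
    omega
  rw [← Finsupp.cons_tail e, he, Finsupp.cons_zero_eq_single_zero]
  exact ho.not_gt_add_single a _

/-- By Dickson's lemma, a strictly ascending chain of monomials of degree `d` in `x` has two terms
`a`, `b` in this order with `a ≤ b` componentwise, so that `b` is `a` times a power of `t`. -/
theorem IsTLocal.wellFounded (ho : o.IsTLocal) (d : ℕ) :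
    WellFounded fun p m : Mon n => p.tail.degree = d ∧ o.gt p m := by
  have := o.isStrictTotalOrder
  rw [wellFounded_iff_isEmpty_descending_chain]
  refine ⟨fun ⟨f, hf⟩ => ?_⟩
  obtain ⟨i, j, hij, hle⟩ := wellQuasiOrdered_le fun i => f (i + 1)
  have hgt : o.gt (f (j + 1)) (f (i + 1)) :=
    Nat.rel_of_forall_rel_succ_of_lt (fun a b => o.gt b a) (f := fun i => f (i + 1))
      (fun k => (hf (k + 1)).2) hij
  exact ho.not_gt_of_le hle ((hf i).1.trans (hf j).1.symm) hgt

end Order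

/-- The elements of `R⟦t⟧[x]` in which no monomial greater than `m` occurs. -/
def boundedBy (o : MonomialOrdering n) (m : Mon n) : Submodule R (MixedRing n R) :=
  ⨅ (p) (_ : o.gt p m), LinearMap.ker (monCoeffₗ p)

theorem mem_boundedBy {o : MonomialOrdering n} {m : Mon n} {f : MixedRing n R} :
    f ∈ o.boundedBy m ↔ ∀ p, o.gt p m → monCoeff p f = 0 := by
  simp [boundedBy]

theorem isLeadingMonomial_iff {o : MonomialOrdering n} {m : Mon n} {f : MixedRing n R} :
    o.IsLeadingMonomial f m ↔ monCoeff m f ≠ 0 ∧ f ∈ o.boundedBy m := by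
  rw [IsLeadingMonomial, mem_boundedBy]
  refine and_congr_right fun _ => ⟨fun h p hp => ?_, fun h p hp hpm => ?_⟩
  · by_contra hpf
    exact o.gt_asymm hp (h p hpf fun hpm => o.gt_irrefl m (hpm ▸ hp))
  · rcases o.gt_trichotomy m p with hmp | rfl | hgt
    · exact hmp
    · exact absurd rfl hpm
    · exact absurd (h p hgt) hp

theorem IsLeadingMonomial.unique {o : MonomialOrdering n} {f : MixedRing n R} {m m' : Mon n}
    (h : o.IsLeadingMonomial f m) (h' : o.IsLeadingMonomial f m') : m = m' := by
  by_contra hne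
  exact o.gt_asymm (h.2 m' h'.1 (Ne.symm hne)) (h'.2 m h.1 hne)

theorem IsLeadingMonomial.leadingTerm_eq {o : MonomialOrdering n} {f : MixedRing n R} {m : Mon n}
    (h : o.IsLeadingMonomial f m) :
    o.leadingTerm f = MvPolynomial.monomial m (monCoeff m f) := by
  have hex : ∃ m, o.IsLeadingMonomial f m := ⟨m, h⟩
  rw [leadingTerm, dif_pos hex, hex.choose_spec.unique h]

theorem mon_mul_mem_boundedBy {o : MonomialOrdering n} {m : Mon n} {f : MixedRing n R}
    (hf : f ∈ o.boundedBy m) (e : Mon n) : mon R e * f ∈ o.boundedBy (m + e) := by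
  rw [mem_boundedBy] at hf ⊢
  intro p hp
  rw [monCoeff_mon_mul]
  split_ifs with hep
  · refine hf _ ?_
    rwa [← o.gt_add_iff (c := e), tsub_add_cancel_of_le hep]
  · rfl

theorem IsTLocal.mem_boundedBy_iff {o : MonomialOrdering n} (ho : o.IsTLocal) {m : Mon n}
    {f : MixedRing n R} : f ∈ o.boundedBy m ↔ ∀ p ∈ lowestMonomials f, ¬o.gt p m := by
  rw [mem_boundedBy]
  refine ⟨fun h p hp hpm => monCoeff_ne_zero_of_mem_lowestMonomials hp (h p hpm),
    fun h p hpm => ?_⟩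
  by_contra hp
  obtain ⟨q, hq, k, rfl⟩ := exists_mem_lowestMonomials hp
  rcases o.gt_trichotomy q m with hqm | rfl | hmq
  · exact h q hq hqm
  · exact ho.not_gt_add_single q k hpm
  · exact ho.not_gt_add_single q k (o.gt_trans hpm hmq)

/-- The coefficients of `m` in those elements of `N` that have no monomial greater than `m`: zero
and the leading coefficients of the elements of `N` with leading monomial `m`. -/
def leadingCoeffs (o : MonomialOrdering n) (N : Submodule R⟦X⟧ (MixedRing n R)) (m : Mon n) :
    Ideal R :=
  (N.restrictScalars R ⊓ o.boundedBy m).map (monCoeffₗ m)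

section LeadingCoeffs

variable {o : MonomialOrdering n} {N N' : Submodule R⟦X⟧ (MixedRing n R)} {m : Mon n}

theorem mem_leadingCoeffs {c : R} :
    c ∈ o.leadingCoeffs N m ↔ ∃ f ∈ N, f ∈ o.boundedBy m ∧ monCoeff m f = c := by
  simp [leadingCoeffs, and_assoc]

theorem leadingCoeffs_mono (h : N ≤ N') : o.leadingCoeffs N m ≤ o.leadingCoeffs N' m :=
  Submodule.map_mono (inf_le_inf_right _ h)

theorem leadingCoeffs_le_X_pow_smul (k : ℕ) :
    o.leadingCoeffs N m ≤
      o.leadingCoeffs ((PowerSeries.X : R⟦X⟧) ^ k • N) (m + Finsupp.single 0 k) := by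
  intro c hc
  obtain ⟨f, hfN, hfm, rfl⟩ := mem_leadingCoeffs.mp hc
  refine mem_leadingCoeffs.mpr
    ⟨PowerSeries.X ^ k • f, Submodule.smul_mem_pointwise_smul _ _ _ hfN, ?_⟩
  rw [X_pow_smul_eq_mon_mul]
  exact ⟨mon_mul_mem_boundedBy hfm _, monCoeff_add_mon_mul _ _ _⟩

theorem leadingCoeffs_le_add (I : Ideal (MixedRing n R)) (e : Mon n) :
    o.leadingCoeffs (I.restrictScalars R⟦X⟧) m ≤
      o.leadingCoeffs (I.restrictScalars R⟦X⟧) (m + e) := by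
  intro c hc
  obtain ⟨f, hfI, hfm, rfl⟩ := mem_leadingCoeffs.mp hc
  exact mem_leadingCoeffs.mpr
    ⟨mon R e * f, I.mul_mem_left _ hfI, mon_mul_mem_boundedBy hfm e, monCoeff_add_mon_mul _ _ _⟩

theorem leadingCoeffs_eq_bot {d : ℕ}
    (hN : N ≤ MvPolynomial.homogeneousSubmodule (Fin n) R⟦X⟧ d) (hm : m.tail.degree ≠ d) :
    o.leadingCoeffs N m = ⊥ := by
  rw [eq_bot_iff]
  intro c hc
  obtain ⟨f, hf, -, rfl⟩ := mem_leadingCoeffs.mp hc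
  by_contra h
  exact hm (degree_tail_of_monCoeff_ne_zero (hN hf) h)

theorem leadingCoeffs_homogeneousPart {I : Ideal (MixedRing n R)} (hI : IsXHomogeneous I) :
    o.leadingCoeffs (homogeneousPart I m.tail.degree) m =
      o.leadingCoeffs (I.restrictScalars R⟦X⟧) m := by
  refine le_antisymm (leadingCoeffs_mono inf_le_left) fun c hc => ?_
  obtain ⟨f, hfI, hfm, rfl⟩ := mem_leadingCoeffs.mp hc
  refine mem_leadingCoeffs.mpr ⟨_, hI.homogeneousComponent_mem _ hfI,
    mem_boundedBy.mpr fun p hp => ?_, ?_⟩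
  · rw [monCoeff_homogeneousComponent, mem_boundedBy.mp hfm p hp, ite_self]
  · rw [monCoeff_homogeneousComponent, if_pos rfl]

theorem exists_forall_leadingCoeffs_le [IsNoetherianRing R] (o : MonomialOrdering n)
    (N : Submodule R⟦X⟧ (MixedRing n R)) (d : ℕ) :
    ∃ C, ∀ m : Mon n, m.tail.degree = d →
      o.leadingCoeffs N m ≤ o.leadingCoeffs N (Finsupp.cons (min (m 0) C) m.tail) := by
  have hstable : ∀ α : Fin n →₀ ℕ, ∃ k, ∀ β, k ≤ β →
      o.leadingCoeffs N (Finsupp.cons k α) = o.leadingCoeffs N (Finsupp.cons β α) := fun α =>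
    WellFoundedGT.monotone_chain_condition
      ⟨fun β => o.leadingCoeffs N (Finsupp.cons β α), monotone_nat_of_le_succ fun β => by
        rw [← cons_add_single]
        exact (leadingCoeffs_le_X_pow_smul 1).trans
          (leadingCoeffs_mono (Submodule.smul_le_self_of_tower _ _))⟩
  choose k hk using hstable
  obtain ⟨C, hC⟩ := ((Finsupp.finite_of_degree_eq d).image k).bddAbove
  refine ⟨C, fun m hm => ?_⟩
  rcases le_total (m 0) C with hle | hle
  · rw [min_eq_left hle, Finsupp.cons_tail]
  · have hkC : k m.tail ≤ C := hC ⟨m.tail, hm, rfl⟩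
    rw [min_eq_right hle, ← hk _ C hkC, hk _ (m 0) (hkC.trans hle), Finsupp.cons_tail]

theorem exists_forall_leadingCoeffs_le_X_pow_smul [IsNoetherianRing R] {o o' : MonomialOrdering n}
    {d : ℕ} (hN : N ≤ MvPolynomial.homogeneousSubmodule (Fin n) R⟦X⟧ d)
    (hle : ∀ m, o.leadingCoeffs N m ≤ o'.leadingCoeffs N m) :
    ∃ C, ∀ m, o.leadingCoeffs N m ≤
      o'.leadingCoeffs ((PowerSeries.X : R⟦X⟧) ^ (m 0 - C) • N) m := by
  obtain ⟨C, hC⟩ := exists_forall_leadingCoeffs_le o N d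
  refine ⟨C, fun m => ?_⟩
  by_cases hm : m.tail.degree = d
  · have hshift : Finsupp.cons (min (m 0) C) m.tail + Finsupp.single 0 (m 0 - C) = m := by
      rw [cons_add_single, show min (m 0) C + (m 0 - C) = m 0 by omega, Finsupp.cons_tail]
    calc o.leadingCoeffs N m
        ≤ o'.leadingCoeffs N (Finsupp.cons (min (m 0) C) m.tail) := (hC m hm).trans (hle _)
      _ ≤ o'.leadingCoeffs ((PowerSeries.X : R⟦X⟧) ^ (m 0 - C) • N)
            (Finsupp.cons (min (m 0) C) m.tail + Finsupp.single 0 (m 0 - C)) :=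
          leadingCoeffs_le_X_pow_smul _
      _ = o'.leadingCoeffs ((PowerSeries.X : R⟦X⟧) ^ (m 0 - C) • N) m := by rw [hshift]
  · exact (leadingCoeffs_eq_bot hN hm).trans_le bot_le

end LeadingCoeffs

section Division

variable {o : MonomialOrdering n} {N : Submodule R⟦X⟧ (MixedRing n R)} {d C : ℕ}

/-- `a p` is the coefficient of `p` left when the division arrives at `p`, from which `w p (a p)`
is subtracted; `g` is the sum of everything subtracted. -/
theorem IsTLocal.exists_reduction (ho : o.IsTLocal) (hN : N.FG) {w : Mon n → R → MixedRing n R}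
    (hwN : ∀ p c, w p c ∈ (PowerSeries.X : R⟦X⟧) ^ (p 0 - C) • N)
    (hwb : ∀ p c, w p c ∈ o.boundedBy p) (f : MixedRing n R) :
    ∃ a : Mon n → R, ∃ g ∈ N,
      (∀ m, m.tail.degree = d → monCoeff m (f - g) = a m - monCoeff m (w m (a m))) ∧
      ∀ m, (∀ p, p.tail.degree = d → o.gt p m → w p (a p) = 0) → a m = monCoeff m f := by
  classical
  obtain ⟨a, ha⟩ := exists_forall_eq_of_wellFounded (ho.wellFounded d)
    (fun (a : Mon n → R) m => monCoeff m f -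
      ∑ p ∈ box n d (C + (m 0 + 1)) with o.gt p m, monCoeff m (w p (a p)))
    fun a b m hab => congrArg _ (Finset.sum_congr rfl fun p hp => by
      rw [Finset.mem_filter, mem_box] at hp
      rw [hab p ⟨hp.1.1, hp.2⟩])
  obtain ⟨g, hgN, hg⟩ := exists_mem_forall_monCoeff_eq_sum hN d C fun p => hwN p (a p)
  refine ⟨a, g, hgN, fun m hm => ?_, fun m hm => ?_⟩
  · have hnotgt : ∑ p ∈ box n d (C + (m 0 + 1)) with ¬o.gt p m, monCoeff m (w p (a p)) =
        monCoeff m (w m (a m)) := by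
      refine Finset.sum_eq_single_of_mem m ?_ fun p hp hpm => ?_
      · exact Finset.mem_filter.mpr ⟨mem_box.mpr ⟨hm, by omega⟩, o.gt_irrefl m⟩
      · exact mem_boundedBy.mp (hwb p _) m
          (((o.gt_trichotomy m p).resolve_right
            (not_or.mpr ⟨Ne.symm hpm, (Finset.mem_filter.mp hp).2⟩)))
    rw [monCoeff_sub, hg, ← Finset.sum_filter_add_sum_filter_not _ (fun p => o.gt p m), hnotgt,
      ha m, sub_sub, ← ha m]
  · rw [ha m, Finset.sum_eq_zero, sub_zero]
    intro p hp
    rw [Finset.mem_filter, mem_box] at hp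
    rw [hm p hp.1.1 hp.2, monCoeff_zero]

theorem exists_reducers {J : Mon n → Ideal R}
    (hJ : ∀ m, J m ≤ o.leadingCoeffs ((PowerSeries.X : R⟦X⟧) ^ (m 0 - C) • N) m) :
    ∃ w : Mon n → R → MixedRing n R,
      (∀ p c, w p c ∈ (PowerSeries.X : R⟦X⟧) ^ (p 0 - C) • N) ∧
      (∀ p c, w p c ∈ o.boundedBy p) ∧ (∀ p, w p 0 = 0) ∧
      (∀ p, ∀ c ∈ J p, monCoeff p (w p c) = c) ∧ ∀ p, ∀ c ∉ J p, w p c = 0 := by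
  classical
  choose v hvN hvb hv using fun p (c : J p) => mem_leadingCoeffs.mp (hJ p c.2)
  refine ⟨fun p c => if h : c ∈ J p ∧ c ≠ 0 then v p ⟨c, h.1⟩ else 0, fun p c => ?_, fun p c => ?_,
    fun p => ?_, fun p c hc => ?_, fun p c hc => ?_⟩
  · dsimp only
    split_ifs
    exacts [hvN _ _, zero_mem _]
  · dsimp only
    split_ifs
    exacts [hvb _ _, zero_mem _]
  · exact dif_neg fun h => h.2 rfl
  · by_cases h0 : c = 0
    · simp [h0]
    · simpa [hc, h0] using hv p ⟨c, hc⟩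
  · exact dif_neg fun h => hc h.1

theorem IsTLocal.exists_remainder (ho : o.IsTLocal) (hN : N.FG)
    (hNd : N ≤ MvPolynomial.homogeneousSubmodule (Fin n) R⟦X⟧ d) {J : Mon n → Ideal R}
    (hJ : ∀ m, J m ≤ o.leadingCoeffs ((PowerSeries.X : R⟦X⟧) ^ (m 0 - C) • N) m)
    {f : MixedRing n R} (hf : f.IsHomogeneous d) :
    ∃ g ∈ N, (∀ m, monCoeff m (f - g) ∈ J m → monCoeff m (f - g) = 0) ∧
      ∀ m, f ∈ o.boundedBy m → monCoeff m g ∈ J m := by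
  obtain ⟨w, hwN, hwb, hw0, hwJ, hwnJ⟩ := exists_reducers hJ
  obtain ⟨a, g, hgN, hfg, ha⟩ := ho.exists_reduction (d := d) hN hwN hwb f
  refine ⟨g, hgN, fun m hm => ?_, fun m hfm => ?_⟩
  · by_contra h0
    rw [hfg m (degree_tail_of_monCoeff_ne_zero (hf.sub (hNd hgN)) h0)] at hm h0
    by_cases ham : a m ∈ J m
    · exact h0 (by rw [hwJ m _ ham, sub_self])
    · rw [hwnJ m _ ham, monCoeff_zero, sub_zero] at hm
      exact ham hm
  · by_cases h0 : monCoeff m g = 0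
    · exact h0 ▸ zero_mem _
    have hgt : ∀ p, o.gt p m → a p = 0 := fun p => by
      induction p using (ho.wellFounded d).induction with
      | h p ih =>
        intro hp
        rw [ha p fun q hq hqp => by rw [ih q ⟨hq, hqp⟩ (o.gt_trans hqp hp), hw0]]
        exact mem_boundedBy.mp hfm p hp
    have hm : monCoeff m g = monCoeff m (w m (a m)) := by
      have ham : a m = monCoeff m f := ha m fun p _ hp => by rw [hgt p hp, hw0]
      have hsub := hfg m (degree_tail_of_monCoeff_ne_zero (hNd hgN) h0)
      rwa [monCoeff_sub, ← ham, sub_right_inj] at hsub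
    rw [hm]
    by_cases ham : a m ∈ J m
    · rwa [hwJ m _ ham]
    · rw [hwnJ m _ ham, monCoeff_zero]
      exact zero_mem _

end Division

theorem leadingCoeffs_le_of_forall_le [IsNoetherianRing R] {o o' : MonomialOrdering n}
    (ho : o.IsTLocal) (ho' : o'.IsTLocal) {N : Submodule R⟦X⟧ (MixedRing n R)} (hN : N.FG) {d : ℕ}
    (hNd : N ≤ MvPolynomial.homogeneousSubmodule (Fin n) R⟦X⟧ d)
    (hle : ∀ m, o.leadingCoeffs N m ≤ o'.leadingCoeffs N m) (m : Mon n) :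
    o'.leadingCoeffs N m ≤ o.leadingCoeffs N m := by
  intro c hc
  obtain ⟨f, hfN, hfm, rfl⟩ := mem_leadingCoeffs.mp hc
  obtain ⟨C, hC⟩ := exists_forall_leadingCoeffs_le_X_pow_smul hNd hle
  obtain ⟨g, hgN, hfg, hg⟩ := ho'.exists_remainder hN hNd hC (hNd hfN)
  have heq : f = g := by
    by_contra hne
    obtain ⟨p, hp⟩ := o.exists_isLeadingMonomial ho (sub_ne_zero.mpr hne)
    obtain ⟨hp0, hpb⟩ := isLeadingMonomial_iff.mp hp
    exact hp0 (hfg p (mem_leadingCoeffs.mpr ⟨f - g, sub_mem hfN hgN, hpb, rfl⟩))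
  rw [heq]
  exact hg m hfm

section LeadingIdeal

variable {o o' : MonomialOrdering n} {I : Ideal (MixedRing n R)}

theorem coeff_leadingTerm_mem_leadingCoeffs {f : MixedRing n R} (hf : f ∈ I) (m : Mon n) :
    MvPolynomial.coeff m (o.leadingTerm f) ∈ o.leadingCoeffs (I.restrictScalars R⟦X⟧) m := by
  by_cases h : ∃ p, o.IsLeadingMonomial f p
  · obtain ⟨p, hp⟩ := h
    rw [hp.leadingTerm_eq, MvPolynomial.coeff_monomial]
    split_ifs with hpm
    · subst hpm
      exact mem_leadingCoeffs.mpr ⟨f, hf, (isLeadingMonomial_iff.mp hp).2, rfl⟩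
    · exact zero_mem _
  · rw [leadingTerm, dif_neg h, MvPolynomial.coeff_zero]
    exact zero_mem _

theorem monomial_mem_leadingIdeal {m : Mon n} {c : R}
    (hc : c ∈ o.leadingCoeffs (I.restrictScalars R⟦X⟧) m) :
    MvPolynomial.monomial m c ∈ o.leadingIdeal I := by
  obtain ⟨f, hf, hfm, rfl⟩ := mem_leadingCoeffs.mp hc
  by_cases h0 : monCoeff m f = 0
  · rw [h0, MvPolynomial.monomial_zero]
    exact zero_mem _
  · rw [← (isLeadingMonomial_iff.mpr ⟨h0, hfm⟩).leadingTerm_eq]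
    exact Ideal.subset_span ⟨f, hf, rfl⟩

theorem mem_leadingIdeal_iff {q : MvPolynomial (Fin (n + 1)) R} :
    q ∈ o.leadingIdeal I ↔
      ∀ m, MvPolynomial.coeff m q ∈ o.leadingCoeffs (I.restrictScalars R⟦X⟧) m := by
  refine ⟨fun hq => ?_, fun hq => ?_⟩
  · induction hq using Submodule.span_induction with
    | mem q hq =>
      obtain ⟨f, hf, rfl⟩ := hq
      exact coeff_leadingTerm_mem_leadingCoeffs hf
    | zero => exact fun m => by simp
    | add p q _ _ hp hq => exact fun m => by simpa using add_mem (hp m) (hq m)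
    | smul p q _ hq =>
      intro m
      rw [smul_eq_mul, MvPolynomial.coeff_mul]
      refine sum_mem fun x hx => Ideal.mul_mem_left _ _ ?_
      rw [← Finset.HasAntidiagonal.mem_antidiagonal.mp hx, add_comm]
      exact leadingCoeffs_le_add I x.1 (hq x.2)
  · rw [q.as_sum]
    exact sum_mem fun m _ => monomial_mem_leadingIdeal (hq m)

theorem leadingIdeal_le_iff :
    o.leadingIdeal I ≤ o'.leadingIdeal I ↔ ∀ m,
      o.leadingCoeffs (I.restrictScalars R⟦X⟧) m ≤ o'.leadingCoeffs (I.restrictScalars R⟦X⟧) m := by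
  refine ⟨fun h m c hc => ?_, fun h q hq => ?_⟩
  · simpa using mem_leadingIdeal_iff.mp (h (monomial_mem_leadingIdeal hc)) m
  · exact mem_leadingIdeal_iff.mpr fun m => h m (mem_leadingIdeal_iff.mp hq m)

theorem leadingIdeal_eq_of_le [IsNoetherianRing R] (hI : IsXHomogeneous I) (ho : o.IsTLocal)
    (ho' : o'.IsTLocal) (h : o.leadingIdeal I ≤ o'.leadingIdeal I) :
    o.leadingIdeal I = o'.leadingIdeal I := by
  refine le_antisymm h (leadingIdeal_le_iff.mpr fun m => ?_)
  rw [← leadingCoeffs_homogeneousPart hI, ← leadingCoeffs_homogeneousPart hI]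
  refine leadingCoeffs_le_of_forall_le ho ho' (homogeneousPart_fg I _) inf_le_right (fun p => ?_) m
  by_cases hp : p.tail.degree = m.tail.degree
  · rw [← hp, leadingCoeffs_homogeneousPart hI, leadingCoeffs_homogeneousPart hI]
    exact leadingIdeal_le_iff.mp h p
  · exact (leadingCoeffs_eq_bot inf_le_right hp).trans_le bot_le

end LeadingIdeal

section Ultralimit

variable {ι : Type*} {U : Ultrafilter ι} {o : ι → MonomialOrdering n} {I : Ideal (MixedRing n R)}

/-- The limit along an ultrafilter of a family of monomial orderings: two monomials compare as
they do for almost all members of the family. -/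
def ultralimit (U : Ultrafilter ι) (o : ι → MonomialOrdering n) : MonomialOrdering n where
  gt a b := ∀ᶠ i in U, (o i).gt a b
  isStrictTotalOrder :=
    { trichotomous := fun a b hab hba => by
        obtain ⟨i, hi, hi'⟩ :=
          ((Ultrafilter.eventually_not.mpr hab).and (Ultrafilter.eventually_not.mpr hba)).exists
        exact (((o i).gt_trichotomy a b).resolve_left hi).resolve_right hi'
      irrefl := fun a h => h.exists.elim fun i => (o i).gt_irrefl a
      trans := fun a b c hab hbc => by
        filter_upwards [hab, hbc] with i using (o i).gt_trans }
  gt_add a b c hab := hab.mono fun i => (o i).gt_add a b c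

theorem ultralimit_isTLocal (ho : ∀ i, (o i).IsTLocal) : (ultralimit U o).IsTLocal :=
  Filter.Eventually.of_forall ho

/-- Whether `f` is bounded by `m` depends on finitely many comparisons only. -/
theorem eventually_mem_boundedBy (ho : ∀ i, (o i).IsTLocal) {f : MixedRing n R} {m : Mon n}
    (hf : f ∈ (ultralimit U o).boundedBy m) : ∀ᶠ i in U, f ∈ (o i).boundedBy m := by
  have hfin : ∀ᶠ i in U, ∀ p ∈ lowestMonomials f, ¬(o i).gt p m :=
    (Filter.eventually_all_finite (lowestMonomials_finite f)).mpr fun p hp =>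
      Ultrafilter.eventually_not.mpr (((ultralimit_isTLocal ho).mem_boundedBy_iff.mp hf) p hp)
  exact hfin.mono fun i => (ho i).mem_boundedBy_iff.mpr

theorem eventually_mem_leadingCoeffs (ho : ∀ i, (o i).IsTLocal)
    {N : Submodule R⟦X⟧ (MixedRing n R)} {m : Mon n} {c : R}
    (hc : c ∈ (ultralimit U o).leadingCoeffs N m) :
    ∀ᶠ i in U, c ∈ (o i).leadingCoeffs N m := by
  obtain ⟨f, hf, hfm, hfc⟩ := mem_leadingCoeffs.mp hc
  exact (eventually_mem_boundedBy ho hfm).mono fun i hi => mem_leadingCoeffs.mpr ⟨f, hf, hi, hfc⟩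

theorem eventually_mem_leadingIdeal (ho : ∀ i, (o i).IsTLocal) {q : MvPolynomial (Fin (n + 1)) R}
    (hq : q ∈ (ultralimit U o).leadingIdeal I) : ∀ᶠ i in U, q ∈ (o i).leadingIdeal I := by
  have hsupp : ∀ᶠ i in U, ∀ m ∈ q.support,
      MvPolynomial.coeff m q ∈ (o i).leadingCoeffs (I.restrictScalars R⟦X⟧) m :=
    (Filter.eventually_all_finset _).mpr fun m _ =>
      eventually_mem_leadingCoeffs ho (mem_leadingIdeal_iff.mp hq m)
  filter_upwards [hsupp] with i hi
  rw [q.as_sum]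
  exact sum_mem fun m hm => monomial_mem_leadingIdeal (hi m hm)

theorem eventually_leadingIdeal_eq [IsNoetherianRing R] (hI : IsXHomogeneous I)
    (ho : ∀ i, (o i).IsTLocal) :
    ∀ᶠ i in U, (o i).leadingIdeal I = (ultralimit U o).leadingIdeal I := by
  obtain ⟨G, hG⟩ := IsNoetherian.noetherian ((ultralimit U o).leadingIdeal I)
  have hgen : ∀ᶠ i in U, ∀ q ∈ G, q ∈ (o i).leadingIdeal I :=
    (Filter.eventually_all_finset G).mpr fun q hq =>
      eventually_mem_leadingIdeal ho (hG ▸ Submodule.subset_span hq)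
  filter_upwards [hgen] with i hi
  exact (leadingIdeal_eq_of_le hI (ultralimit_isTLocal ho) (ho i)
    (hG ▸ Submodule.span_le.mpr hi)).symm

end Ultralimit

end MonomialOrdering

end

theorem proposition2p1 {R : Type*} [CommRing R] [IsNoetherianRing R] (n : ℕ)
    (I : Ideal (MixedRing n R)) (hI : MixedRing.IsXHomogeneous I) :
    Set.Finite {J : Ideal (MvPolynomial (Fin (n + 1)) R) |
      ∃ o : MonomialOrdering n, o.IsTLocal ∧ o.leadingIdeal I = J} := by
  by_contra hinf
  let J := Set.Infinite.natEmbedding _ hinf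
  choose o ho hoJ using fun k => (J k).2
  have hconst := MonomialOrdering.eventually_leadingIdeal_eq (U := Filter.hyperfilter ℕ) hI ho
  have hsub : {k | (o k).leadingIdeal I =
      (MonomialOrdering.ultralimit (Filter.hyperfilter ℕ) o).leadingIdeal I}.Subsingleton :=
    fun k hk l hl => J.injective (Subtype.ext (by rw [← hoJ k, ← hoJ l, hk, hl]))
  exact hsub.finite.notMem_hyperfilter hconst
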